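/- Let $n\ge 1$ and let $d\ge 2$ be even. For a real form $f(x_1,\dots,x_n)$ of degree $d$ (the zero form included), an honest representation of $f$ is an identity $$f=\sum_{j=1}^r\lambda_j(\alpha_{j1}x_1+\dots+\alpha_{jn}x_n)^{d},\qquad r\ge 0,\quad 0\ne\lambda_j\in\mathbb R,\ \alpha_{ji}\in\mathbb R,$$ whose linear forms are pairwise non-proportional (the zero linear form being proportional to every linear form); its badge is $(a,b)$, where $a$ is the number of positive and $b$ the number of negative $\lambda_j$. A signature of $f$ is a badge of $f$ that is minimal, for the componentwise order on $\mathbb N^2$, among the badges of all honest representations of $f$. If $f$ has exactly one signature, it is denoted $S(f)$. Thus a formula involving $S(f)$ includes the assertion that $f$ has exactly one signature. For a real binary quartic form $$p(x,y)=a_0x^4+4a_1x^3y+6a_2x^2y^2+4a_3xy^3+a_4y^4,$$ let $H_p$ be its catalecticant, the quadratic form $H_p(t_0,t_1,t_2)=\sum_{i=0}^2\sum_{j=0}^2a_{i+j}t_it_j$. **Theorem 4.2.** Let $p$ be a real binary quartic form. Then either $S(p)=S(H_p)$, or $p$ is a product of four real linear forms, $p\neq\pm\ell^4$ for every real linear form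 $\ell$ (including $\ell = 0$), and $S(p)=(2,2)$. In particular, if $p$ has a (positive or negative) definite quadratic form as a factor, then $S(p)=S(H_p)$. -/

import Mathlib

namespace BinaryForms

/-- The linear form `v 0 * x₀ + ⋯ + v (n-1) * x₍ₙ₋₁₎` with real coefficient vector `v`. -/
noncomputable def linForm {n : ℕ} (v : Fin n → ℝ) : MvPolynomial (Fin n) ℝ :=
  ∑ i, MvPolynomial.C (v i) * MvPolynomial.X i

/-- `p = ∑ⱼ lam j * (linear form with coefficients α j) ^ d` is an honest representation of `p`:
all `lam j` are nonzero and the linear forms are pairwise non-proportional. -/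
def IsHonestRep {n : ℕ} (d : ℕ) (p : MvPolynomial (Fin n) ℝ) {r : ℕ}
    (lam : Fin r → ℝ) (α : Fin r → Fin n → ℝ) : Prop :=
  p = ∑ j, MvPolynomial.C (lam j) * linForm (α j) ^ d ∧
  (∀ j, lam j ≠ 0) ∧
  (∀ i j, i ≠ j → LinearIndependent ℝ ![α i, α j])

/-- The set of badges of the form `p` of (even) degree `d`: the pairs (number of positive
coefficients, number of negative coefficients) over all honest representations of `p`. -/
def badges {n : ℕ} (d : ℕ) (p : MvPolynomial (Fin n) ℝ) : Set (ℕ × ℕ) :=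
  {ab | ∃ (r : ℕ) (lam : Fin r → ℝ) (α : Fin r → Fin n → ℝ), IsHonestRep d p lam α ∧
    ab = (Nat.card {j // 0 < lam j}, Nat.card {j // lam j < 0})}

/-- The set of signatures of `p`: the badges minimal for the componentwise order. -/
def signatures {n : ℕ} (d : ℕ) (p : MvPolynomial (Fin n) ℝ) : Set (ℕ × ℕ) :=
  {ab | Minimal (fun cd => cd ∈ badges d p) ab}

/-- `p` has a unique signature and it is `ab`. -/
def HasSignature {n : ℕ} (d : ℕ) (p : MvPolynomial (Fin n) ℝ) (ab : ℕ × ℕ) : Prop :=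
  signatures d p = {ab}

/-- The number `aⱼ` in `p = ∑ⱼ (d choose j) * aⱼ * x ^ (d - j) * y ^ j` (for `j ≤ d`). -/
noncomputable def scaledCoeff (d : ℕ) (p : MvPolynomial (Fin 2) ℝ) (j : ℕ) : ℝ :=
  MvPolynomial.coeff (Finsupp.single 0 (d - j) + Finsupp.single 1 j) p / (d.choose j : ℝ)

/-- The catalecticant `H_p(t₀,…,tₛ) = ∑ᵢ ∑ⱼ a₍ᵢ₊ⱼ₎ tᵢ tⱼ` of a binary form `p` of degree `2s`. -/
noncomputable def catalecticant (s : ℕ) (p : MvPolynomial (Fin 2) ℝ) :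
    MvPolynomial (Fin (s + 1)) ℝ :=
  ∑ i : Fin (s + 1), ∑ j : Fin (s + 1),
    MvPolynomial.C (scaledCoeff (2 * s) p (i.val + j.val)) * MvPolynomial.X i * MvPolynomial.X j

/-- `q` is a definite (positive or negative) quadratic form. -/
def IsDefiniteQuadratic {n : ℕ} (q : MvPolynomial (Fin n) ℝ) : Prop :=
  q.IsHomogeneous 2 ∧
  ((∀ v : Fin n → ℝ, v ≠ 0 → 0 < MvPolynomial.eval v q) ∨
   (∀ v : Fin n → ℝ, v ≠ 0 → MvPolynomial.eval v q < 0))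

end BinaryForms

namespace BinaryForms

open Finset

/-! A term `λ (a·x)^4` of `p` contributes `λ (veronese a · t)^2` to `H_p`, so every badge of `p` is
a badge of `H_p` (`badges_subset_badges_catalecticant`). If `p` is a combination of three pairwise
independent fourth powers, zero coefficients allowed, the three Veronese vectors form a basis of
`ℝ^3`. Sylvester's law then makes this badge least for `H_p`, hence also for `p`, and the two
signatures agree (`exists_hasSignature_of_three_terms`).

A real quartic either has a definite quadratic factor or is a product of four real linear forms. In
the first case simultaneous diagonalization gives `(L₁² + L₂²)(A L₁² + B L₂²)`, which is such a
combination (`exists_three_terms`).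

In the second case, `p = ±ℓ^4` is again covered. Otherwise a badge with at most one negative (or
positive) term is impossible: Cauchy–Schwarz on the power sums contradicts Newton's inequality for
the real roots, unless all roots coincide (`eq_mul_pow_of_card_neg_le_one`). Since four fourth
powers always suffice (`exists_four_terms`), the signature is `(2,2)`. -/

theorem eval_linForm {n : ℕ} (v x : Fin n → ℝ) :
    MvPolynomial.eval x (linForm v) = v ⬝ᵥ x := by
  simp [linForm, dotProduct]

theorem linearIndependent_pair_iff (a b : Fin 2 → ℝ) :
    LinearIndependent ℝ ![a, b] ↔ a 0 * b 1 - a 1 * b 0 ≠ 0 := by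
  have h : LinearIndependent ℝ ![a, b] ↔ IsUnit (Matrix.of ![a, b]) :=
    Matrix.linearIndependent_rows_iff_isUnit
  rw [h, Matrix.isUnit_iff_isUnit_det, Matrix.det_fin_two, isUnit_iff_ne_zero]
  simp

/-- Terms with coefficient zero may be dropped from a representation. -/
theorem mem_badges_of_eval {n d : ℕ} {p : MvPolynomial (Fin n) ℝ} {ι : Type*} [Fintype ι]
    (lam : ι → ℝ) (α : ι → Fin n → ℝ)
    (h : ∀ x, MvPolynomial.eval x p = ∑ j, lam j * (α j ⬝ᵥ x) ^ d)
    (hα : ∀ i j, i ≠ j → LinearIndependent ℝ ![α i, α j]) :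
    (Nat.card {j // 0 < lam j}, Nat.card {j // lam j < 0}) ∈ badges d p := by
  classical
  let e := (Fintype.equivFin {j // lam j ≠ 0}).symm
  refine ⟨Fintype.card {j // lam j ≠ 0}, fun k => lam (e k), fun k => α (e k),
    ⟨?_, fun k => (e k).2, fun i j hij => hα _ _ fun h' => hij (e.injective (Subtype.ext h'))⟩, ?_⟩
  · refine MvPolynomial.funext fun x => ?_
    rw [h, map_sum]
    simp only [map_mul, MvPolynomial.eval_C, map_pow, eval_linForm]
    rw [e.sum_comp (fun j : {j // lam j ≠ 0} => lam j * (α j ⬝ᵥ x) ^ d),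
      ← Finset.sum_subtype (univ.filter fun j => lam j ≠ 0) (by simp)
        (fun j => lam j * (α j ⬝ᵥ x) ^ d), Finset.sum_filter]
    refine Finset.sum_congr rfl fun j _ => ?_
    split_ifs with hj
    · rfl
    · rw [not_not.1 hj, zero_mul]
  · congr 1
    · exact Nat.card_congr ((e.subtypeEquiv fun _ => Iff.rfl).trans
        (Equiv.subtypeSubtypeEquivSubtype fun {j} (hj : 0 < lam j) => hj.ne')).symm
    · exact Nat.card_congr ((e.subtypeEquiv fun _ => Iff.rfl).trans
        (Equiv.subtypeSubtypeEquivSubtype fun {j} (hj : lam j < 0) => hj.ne)).symm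

/-! ### Sylvester's law of inertia -/

/-- One half of Sylvester's law of inertia. -/
theorem card_pos_le_of_isUnit {n : ℕ} {κ : Type*} [Fintype κ] (M : Matrix (Fin n) (Fin n) ℝ)
    (hM : IsUnit M) (lam : Fin n → ℝ) (mu : κ → ℝ) (β : κ → Fin n → ℝ)
    (h : ∀ x, ∑ j, lam j * (M j ⬝ᵥ x) ^ 2 = ∑ k, mu k * (β k ⬝ᵥ x) ^ 2) :
    Nat.card {j // 0 < lam j} ≤ Nat.card {k // 0 < mu k} := by
  classical
  -- Vectors in the coordinates `M j` supported on the positive indices are mapped to the values of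
  -- the positive `β k`. On the kernel the left-hand form is nonnegative and the right-hand form
  -- nonpositive, so injectivity follows.
  let T : ({j // 0 < lam j} → ℝ) →ₗ[ℝ] ({k // 0 < mu k} → ℝ) :=
    (Matrix.of fun k : {k // 0 < mu k} => β k).mulVecLin ∘ₗ (M⁻¹).mulVecLin ∘ₗ
      Function.ExtendByZero.linearMap ℝ Subtype.val
  have hT : Function.Injective T := by
    rw [injective_iff_map_eq_zero]
    intro x hx
    set z : Fin n → ℝ := Function.ExtendByZero.linearMap ℝ Subtype.val x with hz
    have hzv : ∀ j : {j // 0 < lam j}, z j = x j := fun j =>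
      Subtype.val_injective.extend_apply x 0 j
    have hz0 : ∀ j, ¬ 0 < lam j → z j = 0 := fun j hj =>
      Function.extend_apply' (f := Subtype.val) x 0 j fun ⟨a, ha⟩ => hj (ha ▸ a.2)
    have hMz : ∀ j, M j ⬝ᵥ (M⁻¹.mulVec z) = z j := fun j => by
      have : M.mulVec (M⁻¹.mulVec z) = z := by
        rw [Matrix.mulVec_mulVec, Matrix.mul_nonsing_inv _ ((Matrix.isUnit_iff_isUnit_det _).1 hM),
          Matrix.one_mulVec]
      exact congrFun this j
    have hle : ∑ j, lam j * z j ^ 2 ≤ 0 := by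
      have := h (M⁻¹.mulVec z)
      simp only [hMz] at this
      rw [this]
      refine Finset.sum_nonpos fun k _ => ?_
      by_cases hk : 0 < mu k
      · have hk0 : β k ⬝ᵥ (M⁻¹.mulVec z) = 0 := congrFun hx ⟨k, hk⟩
        simp [hk0]
      · exact mul_nonpos_of_nonpos_of_nonneg (not_lt.1 hk) (sq_nonneg _)
    have hnn : ∀ j ∈ univ, 0 ≤ lam j * z j ^ 2 := fun j _ => by
      by_cases hj : 0 < lam j
      · positivity
      · simp [hz0 j hj]
    have h0 := (Finset.sum_eq_zero_iff_of_nonneg hnn).1 (le_antisymm hle (Finset.sum_nonneg hnn))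
    funext j
    have := h0 j (mem_univ _)
    rw [hzv] at this
    simpa [j.2.ne'] using this
  simpa [Nat.card_eq_fintype_card] using LinearMap.finrank_le_finrank_of_injective hT

/-! ### Fourth powers, Veronese vectors and the catalecticant -/

/-- The coefficient vector of the square of the linear form dual to `a`. -/
def veronese (a : Fin 2 → ℝ) : Fin 3 → ℝ := ![a 0 ^ 2, a 0 * a 1, a 1 ^ 2]

theorem veronese_linearIndependent_pair {a b : Fin 2 → ℝ} (h : LinearIndependent ℝ ![a, b]) :
    LinearIndependent ℝ ![veronese a, veronese b] := by
  rw [linearIndependent_pair_iff] at h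
  rw [LinearIndependent.pair_iff]
  intro s t hst
  have h0 := congrFun hst 0
  have h1 := congrFun hst 1
  have h2 := congrFun hst 2
  simp [veronese] at h0 h1 h2
  have hs : s * (a 0 * b 1 - a 1 * b 0) ^ 2 = 0 := by
    linear_combination b 1 ^ 2 * h0 - 2 * b 0 * b 1 * h1 + b 0 ^ 2 * h2
  have ht : t * (a 0 * b 1 - a 1 * b 0) ^ 2 = 0 := by
    linear_combination a 1 ^ 2 * h0 - 2 * a 0 * a 1 * h1 + a 0 ^ 2 * h2
  exact ⟨by simpa [h] using hs, by simpa [h] using ht⟩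

/-- The determinant is a homogeneous Vandermonde determinant: the product of the three pairwise 2×2
minors. -/
theorem isUnit_veronese {α : Fin 3 → Fin 2 → ℝ}
    (hα : ∀ i j, i ≠ j → LinearIndependent ℝ ![α i, α j]) :
    IsUnit (Matrix.of fun j => veronese (α j)) := by
  rw [Matrix.isUnit_iff_isUnit_det, isUnit_iff_ne_zero]
  have h01 := (linearIndependent_pair_iff _ _).1 (hα 0 1 (by decide))
  have h02 := (linearIndependent_pair_iff _ _).1 (hα 0 2 (by decide))
  have h12 := (linearIndependent_pair_iff _ _).1 (hα 1 2 (by decide))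
  convert mul_ne_zero (mul_ne_zero h01 h02) h12 using 1
  rw [Matrix.det_fin_three]
  simp [veronese]
  ring

theorem scaledCoeff_linForm_pow (d k : ℕ) (hk : k ≤ d) (a : Fin 2 → ℝ) :
    scaledCoeff d (linForm a ^ d) k = a 0 ^ (d - k) * a 1 ^ k := by
  have h : linForm a ^ d = ∑ m ∈ range (d + 1), MvPolynomial.monomial
      (Finsupp.single 0 (d - m) + Finsupp.single 1 m)
      (a 0 ^ (d - m) * a 1 ^ m * (d.choose m : ℝ)) := by
    rw [linForm, Fin.sum_univ_two, add_comm, add_pow]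
    refine Finset.sum_congr rfl fun m _ => ?_
    simp only [mul_pow, MvPolynomial.monomial_eq, map_mul, map_pow, map_natCast]
    rw [Finsupp.prod_add_index' (by simp) (by simp [pow_add]), Finsupp.prod_single_index (by simp),
      Finsupp.prod_single_index (by simp)]
    ring
  rw [scaledCoeff, h, MvPolynomial.coeff_sum, Finset.sum_eq_single k]
  · rw [MvPolynomial.coeff_monomial, if_pos rfl, mul_div_assoc, div_self, mul_one]
    exact_mod_cast (Nat.choose_pos hk).ne'
  · intro m _ hm
    rw [MvPolynomial.coeff_monomial, if_neg]
    intro h'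
    exact hm (by simpa using DFunLike.congr_fun h' 1)
  · intro h'
    exact absurd (mem_range.2 (Nat.lt_succ_of_le hk)) h'

theorem scaledCoeff_sum {ι : Type*} [Fintype ι] (d k : ℕ) (hk : k ≤ d) (lam : ι → ℝ)
    (α : ι → Fin 2 → ℝ) :
    scaledCoeff d (∑ j, MvPolynomial.C (lam j) * linForm (α j) ^ d) k =
      ∑ j, lam j * (α j 0 ^ (d - k) * α j 1 ^ k) := by
  rw [scaledCoeff, MvPolynomial.coeff_sum, Finset.sum_div]
  refine Finset.sum_congr rfl fun j _ => ?_
  rw [MvPolynomial.coeff_C_mul, mul_div_assoc, ← scaledCoeff_linForm_pow d k hk]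
  rfl

theorem eval_catalecticant {ι : Type*} [Fintype ι] {p : MvPolynomial (Fin 2) ℝ} (lam : ι → ℝ)
    (α : ι → Fin 2 → ℝ) (h : ∀ x, MvPolynomial.eval x p = ∑ j, lam j * (α j ⬝ᵥ x) ^ 4)
    (t : Fin 3 → ℝ) :
    MvPolynomial.eval t (catalecticant 2 p) = ∑ j, lam j * (veronese (α j) ⬝ᵥ t) ^ 2 := by
  have hp : p = ∑ j, MvPolynomial.C (lam j) * linForm (α j) ^ 4 :=
    MvPolynomial.funext fun x => by simp [h, eval_linForm]
  have hs : ∀ k ≤ 4, scaledCoeff 4 p k = ∑ j, lam j * (α j 0 ^ (4 - k) * α j 1 ^ k) :=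
    fun k hk => by rw [hp, scaledCoeff_sum 4 k hk]
  have h0 := hs 0 (by decide)
  have h1 := hs 1 (by decide)
  have h2 := hs 2 (by decide)
  have h3 := hs 3 (by decide)
  have h4 := hs 4 (by decide)
  simp only [catalecticant, Fin.sum_univ_three, dotProduct, veronese, map_add, map_mul,
    MvPolynomial.eval_C, MvPolynomial.eval_X, Nat.reduceMul, Nat.reduceAdd]
  simp [h0, h1, h2, h3, h4]
  simp only [Finset.sum_mul, ← Finset.sum_add_distrib]
  refine Finset.sum_congr rfl fun j _ => ?_
  ring

theorem badges_subset_badges_catalecticant (p : MvPolynomial (Fin 2) ℝ) :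
    badges 4 p ⊆ badges 2 (catalecticant 2 p) := by
  rintro _ ⟨r, lam, α, ⟨hp, h0, hα⟩, rfl⟩
  refine mem_badges_of_eval lam (fun j => veronese (α j)) (fun t => ?_)
    fun i j hij => veronese_linearIndependent_pair (hα i j hij)
  exact eval_catalecticant lam α (fun x => by simp [hp, eval_linForm]) t

theorem hasSignature_of_isLeast {n d : ℕ} {p : MvPolynomial (Fin n) ℝ} {σ : ℕ × ℕ}
    (h : IsLeast (badges d p) σ) : HasSignature d p σ := by
  ext τ
  refine ⟨fun hτ => le_antisymm (hτ.2 h.1 (h.2 hτ.1)) (h.2 hτ.1), ?_⟩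
  rintro rfl
  exact ⟨h.1, fun _ hy _ => h.2 hy⟩

/-- If `p` is a combination of three pairwise independent fourth powers then `S(p) = S(H_p)`. -/
theorem exists_hasSignature_of_three_terms {p : MvPolynomial (Fin 2) ℝ} (lam : Fin 3 → ℝ)
    (α : Fin 3 → Fin 2 → ℝ) (h : ∀ x, MvPolynomial.eval x p = ∑ j, lam j * (α j ⬝ᵥ x) ^ 4)
    (hα : ∀ i j, i ≠ j → LinearIndependent ℝ ![α i, α j]) :
    ∃ σ : ℕ × ℕ, HasSignature 4 p σ ∧ HasSignature 2 (catalecticant 2 p) σ := by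
  have hmem := mem_badges_of_eval lam α h hα
  have hlow : (Nat.card {j // 0 < lam j}, Nat.card {j // lam j < 0}) ∈
      lowerBounds (badges 2 (catalecticant 2 p)) := by
    rintro _ ⟨r, mu, β, ⟨hq, -, -⟩, rfl⟩
    have key : ∀ t, ∑ j, lam j * (veronese (α j) ⬝ᵥ t) ^ 2 = ∑ k, mu k * (β k ⬝ᵥ t) ^ 2 := by
      intro t
      rw [← eval_catalecticant lam α h t, hq]
      simp [eval_linForm]
    refine ⟨card_pos_le_of_isUnit _ (isUnit_veronese hα) lam mu β key, ?_⟩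
    -- Negative terms are counted by applying the same inequality to the negated forms.
    have := card_pos_le_of_isUnit _ (isUnit_veronese hα) (fun j => -lam j) (fun k => -mu k) β
      fun t => by simpa [-Matrix.of_apply] using! congrArg Neg.neg (key t)
    simpa using this
  -- The inclusion is used twice: it transfers the lower bound from `H_p` to `p`, and the attained
  -- badge from `p` to `H_p`.
  have hsub := badges_subset_badges_catalecticant p
  exact ⟨_, hasSignature_of_isLeast ⟨hmem, fun _ hτ => hlow (hsub hτ)⟩,
    hasSignature_of_isLeast ⟨hsub hmem, hlow⟩⟩

/-! ### Coordinates, and the bound `(2,2)` for products of real linear forms -/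

theorem exists_forall_eval_eq_sum {d : ℕ} {p : MvPolynomial (Fin 2) ℝ} (hp : p.IsHomogeneous d) :
    ∃ c : ℕ → ℝ, ∀ x, MvPolynomial.eval x p =
      ∑ j ∈ range (d + 1), c j * x 0 ^ (d - j) * x 1 ^ j := by
  classical
  let g : ℕ → Fin 2 →₀ ℕ := fun j => Finsupp.single 0 (d - j) + Finsupp.single 1 j
  have hg : Function.Injective g := fun i j hij => by simpa [g] using DFunLike.congr_fun hij 1
  refine ⟨fun j => p.coeff (g j), fun x => ?_⟩
  have hsub : p.support ⊆ (range (d + 1)).image g := fun m hm => by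
    have hdeg := hp (MvPolynomial.mem_support_iff.1 hm)
    have hd : m 0 + m 1 = d := by
      rw [← hdeg, Finsupp.weight_apply, Finsupp.sum_fintype _ _ (by simp)]
      simp
    refine mem_image.2 ⟨m 1, mem_range.2 (by omega), ?_⟩
    ext i
    fin_cases i
    · simp [g]; omega
    · simp [g]
  rw [MvPolynomial.eval_eq', Finset.sum_subset hsub, Finset.sum_image hg.injOn]
  · refine Finset.sum_congr rfl fun j _ => ?_
    simp [g, mul_assoc]
  · intro m _ hm
    rw [MvPolynomial.notMem_support_iff.1 hm, zero_mul]

/-- A vector orthogonal to `v`. -/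
def perp (v : Fin 2 → ℝ) : Fin 2 → ℝ := ![-v 1, v 0]

theorem dotProduct_self_pos {v : Fin 2 → ℝ} (hv : v ≠ 0) : 0 < v ⬝ᵥ v := by
  refine lt_of_le_of_ne (Finset.sum_nonneg fun i _ => mul_self_nonneg _) fun h => hv ?_
  exact dotProduct_self_eq_zero.1 h.symm

theorem dotProduct_perp_expansion (v w x : Fin 2 → ℝ) :
    (v ⬝ᵥ v) * (w ⬝ᵥ x) = (perp v ⬝ᵥ x) * (w ⬝ᵥ perp v) + (v ⬝ᵥ x) * (w ⬝ᵥ v) := by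
  simp [dotProduct, perp, Fin.sum_univ_two]
  ring

theorem quartic_coeff_eq {c0 c1 c2 c3 c4 d0 d1 d2 d3 d4 : ℝ}
    (h : ∀ t : ℝ, c0 + c1 * t + c2 * t ^ 2 + c3 * t ^ 3 + c4 * t ^ 4 =
      d0 + d1 * t + d2 * t ^ 2 + d3 * t ^ 3 + d4 * t ^ 4) :
    c0 = d0 ∧ c1 = d1 ∧ c2 = d2 ∧ c3 = d3 ∧ c4 = d4 := by
  have h0 := h 0
  have h1 := h 1
  have h2 := h (-1)
  have h3 := h 2
  have h4 := h (-2)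
  norm_num at h0 h1 h2 h3 h4
  refine ⟨?_, ?_, ?_, ?_, ?_⟩ <;> linarith

/-- At most one linear form has to vanish at `v`, and in the plane each one has a nontrivial zero.
-/
theorem exists_ne_zero_dotProduct_eq_zero {ι : Type*} [Finite ι] (lam : ι → ℝ)
    (α : ι → Fin 2 → ℝ) (hcard : Nat.card {j // lam j < 0} ≤ 1) :
    ∃ v : Fin 2 → ℝ, v ≠ 0 ∧ ∀ j, lam j < 0 → α j ⬝ᵥ v = 0 := by
  have hsub := Finite.card_le_one_iff_subsingleton.1 hcard
  have h1 : (![1, 0] : Fin 2 → ℝ) ≠ 0 := fun h => one_ne_zero (congrFun h 0)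
  by_cases h : ∃ j, lam j < 0 ∧ α j ≠ 0
  · obtain ⟨j, hj, hα⟩ := h
    refine ⟨perp (α j), fun h0 => hα ?_, fun k hk => ?_⟩
    · have e0 := congrFun h0 0
      have e1 := congrFun h0 1
      simp [perp] at e0 e1
      ext i
      fin_cases i
      · exact e1
      · exact e0
    · have hkj : k = j := congrArg Subtype.val (hsub.elim ⟨k, hk⟩ ⟨j, hj⟩)
      subst hkj
      simp [perp, dotProduct, Fin.sum_univ_two]
      ring
  · push Not at h
    exact ⟨_, h1, fun j hj => by simp [h j hj]⟩

/-- Newton's inequality `3 e₃² ≥ 8 e₂ e₄` in homogeneous form, with the defect written as a sum of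
squares that vanish together when the roots coincide. -/
theorem sum_sq_minors (W Z : Fin 4 → ℝ) :
    3 * (W 0 * Z 1 * Z 2 * Z 3 + Z 0 * W 1 * Z 2 * Z 3 + Z 0 * Z 1 * W 2 * Z 3 +
        Z 0 * Z 1 * Z 2 * W 3) ^ 2 -
      8 * (W 0 * W 1 * Z 2 * Z 3 + W 0 * Z 1 * W 2 * Z 3 + W 0 * Z 1 * Z 2 * W 3 +
        Z 0 * W 1 * W 2 * Z 3 + Z 0 * W 1 * Z 2 * W 3 + Z 0 * Z 1 * W 2 * W 3) *
        (Z 0 * Z 1 * Z 2 * Z 3) =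
    ((W 0 * Z 1 - W 1 * Z 0) * (Z 2 * Z 3)) ^ 2 + ((W 0 * Z 2 - W 2 * Z 0) * (Z 1 * Z 3)) ^ 2 +
      ((W 0 * Z 3 - W 3 * Z 0) * (Z 1 * Z 2)) ^ 2 + ((W 1 * Z 2 - W 2 * Z 1) * (Z 0 * Z 3)) ^ 2 +
      ((W 1 * Z 3 - W 3 * Z 1) * (Z 0 * Z 2)) ^ 2 + ((W 2 * Z 3 - W 3 * Z 2) * (Z 0 * Z 1)) ^ 2 := by
  ring

/-- A product of four real linear forms which is a combination of fourth powers with at most one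
negative coefficient is a multiple of a fourth power. -/
theorem eq_mul_pow_of_card_neg_le_one {ι : Type*} [Fintype ι] (w : Fin 4 → Fin 2 → ℝ)
    (lam : ι → ℝ) (α : ι → Fin 2 → ℝ)
    (h : ∀ x, ∏ k, (w k ⬝ᵥ x) = ∑ j, lam j * (α j ⬝ᵥ x) ^ 4)
    (hcard : Nat.card {j // lam j < 0} ≤ 1) :
    ∃ (c : ℝ) (l : Fin 2 → ℝ), ∀ x, ∏ k, (w k ⬝ᵥ x) = c * (l ⬝ᵥ x) ^ 4 := by
  obtain ⟨v, hv, hneg⟩ := exists_ne_zero_dotProduct_eq_zero lam α hcard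
  have hN := (dotProduct_self_pos hv).ne'
  set N := v ⬝ᵥ v with hNdef
  set W : Fin 4 → ℝ := fun k => w k ⬝ᵥ perp v with hW
  set Z : Fin 4 → ℝ := fun k => w k ⬝ᵥ v with hZ
  set a : ι → ℝ := fun j => α j ⬝ᵥ perp v with ha
  set b : ι → ℝ := fun j => α j ⬝ᵥ v with hb
  have hw : ∀ k x, N * (w k ⬝ᵥ x) = (perp v ⬝ᵥ x) * W k + (v ⬝ᵥ x) * Z k :=
    fun k x => dotProduct_perp_expansion v (w k) x
  have hα : ∀ j x, N * (α j ⬝ᵥ x) = (perp v ⬝ᵥ x) * a j + (v ⬝ᵥ x) * b j :=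
    fun j x => dotProduct_perp_expansion v (α j) x
  have hlb : ∀ j, 0 ≤ lam j ∨ b j = 0 := fun j => (le_or_gt 0 (lam j)).imp_right (hneg j)
  -- Both sides are expanded along `perp v + t • v`. As `v` kills the negative terms, the sums in
  -- `d2` and `d4` have only nonnegative summands.
  obtain ⟨-, -, e2, e3, e4⟩ := quartic_coeff_eq (c0 := ∏ k, W k)
    (c1 := W 0 * W 1 * W 2 * Z 3 + W 0 * W 1 * Z 2 * W 3 + W 0 * Z 1 * W 2 * W 3 +
      Z 0 * W 1 * W 2 * W 3)
    (c2 := W 0 * W 1 * Z 2 * Z 3 + W 0 * Z 1 * W 2 * Z 3 + W 0 * Z 1 * Z 2 * W 3 +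
      Z 0 * W 1 * W 2 * Z 3 + Z 0 * W 1 * Z 2 * W 3 + Z 0 * Z 1 * W 2 * W 3)
    (c3 := W 0 * Z 1 * Z 2 * Z 3 + Z 0 * W 1 * Z 2 * Z 3 + Z 0 * Z 1 * W 2 * Z 3 +
      Z 0 * Z 1 * Z 2 * W 3)
    (c4 := Z 0 * Z 1 * Z 2 * Z 3)
    (d0 := ∑ j, lam j * a j ^ 4) (d1 := 4 * ∑ j, lam j * (a j ^ 3 * b j))
    (d2 := 6 * ∑ j, lam j * (a j ^ 2 * b j ^ 2)) (d3 := 4 * ∑ j, lam j * (a j * b j ^ 3))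
    (d4 := ∑ j, lam j * b j ^ 4) (fun t => by
      have := h (perp v + t • v)
      simp only [dotProduct_add, dotProduct_smul, smul_eq_mul] at this
      rw [Fin.prod_univ_four] at this
      rw [Fin.prod_univ_four]
      calc _ = ∑ j, lam j * (a j + t * b j) ^ 4 := by
            rw [← this]
            simp only [hW, hZ]
            ring
        _ = _ := by
            simp only [Finset.mul_sum, Finset.sum_mul, ← Finset.sum_add_distrib]
            exact Finset.sum_congr rfl fun j _ => by ring)
  have hf : ∀ j ∈ univ, 0 ≤ lam j * (a j ^ 2 * b j ^ 2) := fun j _ => by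
    rcases hlb j with hj | hj
    · positivity
    · simp [hj]
  have hg : ∀ j ∈ univ, 0 ≤ lam j * b j ^ 4 := fun j _ => by
    rcases hlb j with hj | hj
    · positivity
    · simp [hj]
  -- If `p(v) = 0`, every form with nonzero coefficient vanishes at `v`, hence is a multiple of
  -- `perp v`.
  by_cases h4 : ∑ j, lam j * b j ^ 4 = 0
  · have hj0 := (Finset.sum_eq_zero_iff_of_nonneg hg).1 h4
    refine ⟨(∑ j, lam j * a j ^ 4) / N ^ 4, perp v, fun x => ?_⟩
    rw [h, eq_comm, div_mul_eq_mul_div, div_eq_iff (pow_ne_zero 4 hN), Finset.sum_mul,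
      Finset.sum_mul]
    refine Finset.sum_congr rfl fun j hj => ?_
    rcases mul_eq_zero.1 (hj0 j hj) with hl | hl
    · simp [hl]
    · have hb0 : b j = 0 := by simpa using hl
      have := hα j x
      rw [hb0, mul_zero, add_zero] at this
      calc _ = lam j * ((perp v ⬝ᵥ x) * a j) ^ 4 := by ring
        _ = _ := by rw [← this]; ring
  -- By `e2`, `e3`, `e4` the sum of squared minors equals 48 times the difference of the two sides
  -- here, so it is nonpositive and every minor vanishes.
  · have hcs : (∑ j, lam j * (a j * b j ^ 3)) ^ 2 ≤
        (∑ j, lam j * (a j ^ 2 * b j ^ 2)) * ∑ j, lam j * b j ^ 4 :=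
      Finset.sum_sq_le_sum_mul_sum_of_sq_le_mul univ hf hg fun j _ =>
        le_of_eq (by ring)
    have hS := sum_sq_minors W Z
    rw [e2, e3, e4] at hS
    rw [← e4] at h4
    have hZ0 : Z 0 ≠ 0 := fun h' => h4 (by simp [h'])
    have hZ1 : Z 1 ≠ 0 := fun h' => h4 (by simp [h'])
    have hZ2 : Z 2 ≠ 0 := fun h' => h4 (by simp [h'])
    have hZ3 : Z 3 ≠ 0 := fun h' => h4 (by simp [h'])
    have hzero : ∀ {A B : ℝ}, B ≠ 0 → (A * B) ^ 2 ≤ 0 → A = 0 := fun {A B} hB hAB => by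
      have := pow_eq_zero_iff (two_ne_zero) |>.1 (le_antisymm hAB (sq_nonneg _))
      exact (mul_eq_zero.1 this).resolve_right hB
    have m1 : W 0 * Z 1 - W 1 * Z 0 = 0 := hzero (mul_ne_zero hZ2 hZ3) (by
      nlinarith only [hS, hcs, sq_nonneg ((W 0 * Z 2 - W 2 * Z 0) * (Z 1 * Z 3)),
        sq_nonneg ((W 0 * Z 3 - W 3 * Z 0) * (Z 1 * Z 2)),
        sq_nonneg ((W 1 * Z 2 - W 2 * Z 1) * (Z 0 * Z 3)),
        sq_nonneg ((W 1 * Z 3 - W 3 * Z 1) * (Z 0 * Z 2)),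
        sq_nonneg ((W 2 * Z 3 - W 3 * Z 2) * (Z 0 * Z 1))])
    have m2 : W 0 * Z 2 - W 2 * Z 0 = 0 := hzero (mul_ne_zero hZ1 hZ3) (by
      nlinarith only [hS, hcs, sq_nonneg ((W 0 * Z 1 - W 1 * Z 0) * (Z 2 * Z 3)),
        sq_nonneg ((W 0 * Z 3 - W 3 * Z 0) * (Z 1 * Z 2)),
        sq_nonneg ((W 1 * Z 2 - W 2 * Z 1) * (Z 0 * Z 3)),
        sq_nonneg ((W 1 * Z 3 - W 3 * Z 1) * (Z 0 * Z 2)),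
        sq_nonneg ((W 2 * Z 3 - W 3 * Z 2) * (Z 0 * Z 1))])
    have m3 : W 0 * Z 3 - W 3 * Z 0 = 0 := hzero (mul_ne_zero hZ1 hZ2) (by
      nlinarith only [hS, hcs, sq_nonneg ((W 0 * Z 1 - W 1 * Z 0) * (Z 2 * Z 3)),
        sq_nonneg ((W 0 * Z 2 - W 2 * Z 0) * (Z 1 * Z 3)),
        sq_nonneg ((W 1 * Z 2 - W 2 * Z 1) * (Z 0 * Z 3)),
        sq_nonneg ((W 1 * Z 3 - W 3 * Z 1) * (Z 0 * Z 2)),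
        sq_nonneg ((W 2 * Z 3 - W 3 * Z 2) * (Z 0 * Z 1))])
    have hprop : ∀ k, W 0 * Z k - W k * Z 0 = 0 := fun k => by
      fin_cases k
      · simp
      · exact m1
      · exact m2
      · exact m3
    have hwk : ∀ k x, w k ⬝ᵥ x = Z k / Z 0 * (w 0 ⬝ᵥ x) := fun k x => by
      rw [div_mul_eq_mul_div, eq_div_iff hZ0]
      refine mul_left_cancel₀ hN ?_
      linear_combination Z 0 * hw k x - Z k * hw 0 x - (perp v ⬝ᵥ x) * hprop k
    refine ⟨∏ k, Z k / Z 0, w 0, fun x => ?_⟩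
    rw [Finset.prod_congr rfl fun k _ => hwk k x, Finset.prod_mul_distrib]
    simp

theorem eq_linForm_pow_or_neg {n : ℕ} {p : MvPolynomial (Fin n) ℝ} {c : ℝ} {l : Fin n → ℝ}
    (h : ∀ x, MvPolynomial.eval x p = c * (l ⬝ᵥ x) ^ 4) :
    ∃ v, p = linForm v ^ 4 ∨ p = -linForm v ^ 4 := by
  have h4 : √√|c| ^ 4 = |c| := by
    rw [show (4 : ℕ) = 2 * 2 from rfl, pow_mul, Real.sq_sqrt (Real.sqrt_nonneg _),
      Real.sq_sqrt (abs_nonneg _)]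
  refine ⟨√√|c| • l, ?_⟩
  rcases le_total 0 c with hc | hc
  · refine Or.inl (MvPolynomial.funext fun x => ?_)
    rw [h, map_pow, eval_linForm, smul_dotProduct, smul_eq_mul, mul_pow, h4, abs_of_nonneg hc]
  · refine Or.inr (MvPolynomial.funext fun x => ?_)
    rw [h, map_neg, map_pow, eval_linForm, smul_dotProduct, smul_eq_mul, mul_pow, h4,
      abs_of_nonpos hc]
    ring

theorem two_two_le_of_mem_badges {p : MvPolynomial (Fin 2) ℝ} {w : Fin 4 → Fin 2 → ℝ}
    (hw : p = ∏ k, linForm (w k)) (hp : ∀ v, p ≠ linForm v ^ 4 ∧ p ≠ -linForm v ^ 4)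
    {σ : ℕ × ℕ} (hσ : σ ∈ badges 4 p) : (2, 2) ≤ σ := by
  obtain ⟨r, lam, α, ⟨hrep, -, -⟩, rfl⟩ := hσ
  have hev : ∀ x, MvPolynomial.eval x p = ∏ k, (w k ⬝ᵥ x) := fun x => by
    simp [hw, map_prod, eval_linForm]
  have hsum : ∀ x, MvPolynomial.eval x p = ∑ j, lam j * (α j ⬝ᵥ x) ^ 4 := fun x => by
    conv_lhs => rw [hrep]
    simp [eval_linForm]
  constructor
  · by_contra hlt
    -- Flipping the sign of one factor writes `-p` as a product of linear forms, exchanging positive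
    -- and negative terms.
    have hprod : ∀ x, ∏ k, (Function.update w 0 (-w 0) k ⬝ᵥ x) = -∏ k, (w k ⬝ᵥ x) := fun x => by
      simp [Fin.prod_univ_four]
      ring
    obtain ⟨c, l, hcl⟩ := eq_mul_pow_of_card_neg_le_one (Function.update w 0 (-w 0))
      (fun j => -lam j) α (fun x => by rw [hprod, ← hev, hsum]; simp)
      (by simp only [neg_lt_zero]; exact Nat.le_of_lt_succ (not_le.1 hlt))
    obtain ⟨v, hv⟩ := eq_linForm_pow_or_neg (p := p) (c := -c) (l := l) fun x => by
      rw [hev, neg_mul, ← hcl, hprod, neg_neg]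
    exact hv.elim (hp v).1 (hp v).2
  · by_contra hlt
    obtain ⟨c, l, hcl⟩ := eq_mul_pow_of_card_neg_le_one w lam α (fun x => by rw [← hev, hsum])
      (Nat.le_of_lt_succ (not_le.1 hlt))
    obtain ⟨v, hv⟩ := eq_linForm_pow_or_neg (p := p) (c := c) (l := l) fun x => by rw [hev, hcl]
    exact hv.elim (hp v).1 (hp v).2

/-! ### Four fourth powers suffice -/

/-- With `X = x₀ + κx₁` and `Y = x₁ - κx₀`, the powers of `X`, `Y`, `X + Y`, `X - Y` span the
quartics whose `X³Y` and `XY³` coefficients agree. A suitable rotation achieves this equality. -/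
theorem exists_four_terms {p : MvPolynomial (Fin 2) ℝ} (hp : p.IsHomogeneous 4) :
    ∃ (lam : Fin 4 → ℝ) (α : Fin 4 → Fin 2 → ℝ),
      (∀ x, MvPolynomial.eval x p = ∑ j, lam j * (α j ⬝ᵥ x) ^ 4) ∧
      ∀ i j, i ≠ j → LinearIndependent ℝ ![α i, α j] := by
  obtain ⟨c, hc⟩ := exists_forall_eval_eq_sum hp
  -- The expression is the difference of the `X³Y` and `XY³` coefficients, up to a power of `1 +
  -- κ²`. Its values at 0 and 1 have opposite signs or both vanish.
  obtain ⟨κ, hκ⟩ : ∃ κ : ℝ, (c 1 - c 3) * (1 - 6 * κ ^ 2 + κ ^ 4) +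
      (c 2 - c 0 - c 4) * (4 * κ - 4 * κ ^ 3) = 0 := by
    let φ : ℝ → ℝ := fun κ => (c 1 - c 3) * (1 - 6 * κ ^ 2 + κ ^ 4) +
      (c 2 - c 0 - c 4) * (4 * κ - 4 * κ ^ 3)
    have hφ : ContinuousOn φ (Set.uIcc 0 1) := by fun_prop
    have h0 : φ 0 = c 1 - c 3 := by simp [φ]
    have h1 : φ 1 = -4 * (c 1 - c 3) := by simp only [φ]; ring
    have hmem : (0 : ℝ) ∈ Set.uIcc (φ 0) (φ 1) := by
      rw [h0, h1, Set.mem_uIcc]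
      rcases le_total 0 (c 1 - c 3) with h | h
      · exact Or.inr ⟨by linarith, h⟩
      · exact Or.inl ⟨h, by linarith⟩
    obtain ⟨κ, -, hκ⟩ := intermediate_value_uIcc hφ hmem
    exact ⟨κ, hκ⟩
  have hN : (1 + κ ^ 2) ≠ 0 := by positivity
  set A0 := c 0 + c 1 * κ + c 2 * κ ^ 2 + c 3 * κ ^ 3 + c 4 * κ ^ 4 with hA0
  set A1 := c 0 * (-4 * κ) + c 1 * (1 - 3 * κ ^ 2) + c 2 * (2 * κ * (1 - κ ^ 2)) +
    c 3 * (3 * κ ^ 2 - κ ^ 4) + c 4 * (4 * κ ^ 3) with hA1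
  set A2 := c 0 * (6 * κ ^ 2) + c 1 * (3 * κ ^ 3 - 3 * κ) + c 2 * ((1 - κ ^ 2) ^ 2 - 2 * κ ^ 2) +
    c 3 * (3 * κ - 3 * κ ^ 3) + c 4 * (6 * κ ^ 2) with hA2
  set A4 := c 0 * κ ^ 4 - c 1 * κ ^ 3 + c 2 * κ ^ 2 - c 3 * κ + c 4 with hA4
  refine ⟨![(A0 - A2 / 6) / (1 + κ ^ 2) ^ 4, (A4 - A2 / 6) / (1 + κ ^ 2) ^ 4,
      (A2 / 12 + A1 / 8) / (1 + κ ^ 2) ^ 4, (A2 / 12 - A1 / 8) / (1 + κ ^ 2) ^ 4],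
    ![![1, κ], ![-κ, 1], ![1 - κ, 1 + κ], ![1 + κ, κ - 1]], fun x => ?_, ?_⟩
  · rw [hc]
    simp only [Finset.sum_range_succ, Finset.sum_range_zero, Fin.sum_univ_four, dotProduct,
      Fin.sum_univ_two]
    simp
    rw [← mul_left_inj' (pow_ne_zero 4 hN)]
    field_simp
    rw [hA0, hA1, hA2, hA4]
    linear_combination (- (x 0 + κ * x 1) * (x 1 - κ * x 0) ^ 3 * 576) * hκ
  · intro i j hij
    rw [linearIndependent_pair_iff]
    fin_cases i <;> fin_cases j <;> first | exact absurd rfl hij | skip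
    all_goals
      simp
      intro h
      apply hN
      nlinarith only [h]

/-! ### A definite quadratic factor gives three fourth powers -/

theorem pairwise_linearIndependent_of_ne_zero {L₁ L₂ : Fin 2 → ℝ}
    (h : LinearIndependent ℝ ![L₁, L₂]) {s : ℝ} (hs : s ≠ 0) (i j : Fin 3) (hij : i ≠ j) :
    LinearIndependent ℝ ![(![L₁, s • L₁ + L₂, s • L₁ - L₂] : Fin 3 → Fin 2 → ℝ) i,
      (![L₁, s • L₁ + L₂, s • L₁ - L₂] : Fin 3 → Fin 2 → ℝ) j] := by
  rw [linearIndependent_pair_iff] at h ⊢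
  have hs' := mul_ne_zero hs h
  fin_cases i <;> fin_cases j <;> first | exact absurd rfl hij | skip
  all_goals
    simp
    intro h'
    first
    | exact h (by linarith only [h'])
    | exact hs' (by linarith only [h'])

theorem exists_three_terms_of_pos {p : MvPolynomial (Fin 2) ℝ} {L₁ L₂ : Fin 2 → ℝ}
    (hL : LinearIndependent ℝ ![L₁, L₂]) {A B : ℝ}
    (hp : ∀ x, MvPolynomial.eval x p =
      ((L₁ ⬝ᵥ x) ^ 2 + (L₂ ⬝ᵥ x) ^ 2) * (A * (L₁ ⬝ᵥ x) ^ 2 + B * (L₂ ⬝ᵥ x) ^ 2))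
    (hpos : 0 < (A + B) * B) :
    ∃ (lam : Fin 3 → ℝ) (α : Fin 3 → Fin 2 → ℝ),
      (∀ x, MvPolynomial.eval x p = ∑ j, lam j * (α j ⬝ᵥ x) ^ 4) ∧
      ∀ i j, i ≠ j → LinearIndependent ℝ ![α i, α j] := by
  have hB : B ≠ 0 := fun h => by simp [h] at hpos
  -- `(B/2)((sX+Y)^4 + (sX-Y)^4)` has middle coefficient `6Bs²`, to be matched with `A + B`.
  have hq : 0 < (A + B) / (6 * B) := by
    rw [show (A + B) / (6 * B) = (A + B) * B / (6 * B ^ 2) by field_simp]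
    positivity
  have hs : √((A + B) / (6 * B)) ^ 2 = (A + B) / (6 * B) := Real.sq_sqrt hq.le
  have hs0 := (Real.sqrt_pos.2 hq).ne'
  set s := √((A + B) / (6 * B))
  have hsB : s ^ 2 * (6 * B) = A + B := by rw [hs]; field_simp
  refine ⟨![A - B * s ^ 4, B / 2, B / 2], ![L₁, s • L₁ + L₂, s • L₁ - L₂], fun x => ?_,
    pairwise_linearIndependent_of_ne_zero hL hs0⟩
  rw [hp, Fin.sum_univ_three]
  simp only [Matrix.cons_val_zero, Matrix.cons_val_one, Matrix.cons_val, add_dotProduct,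
    sub_dotProduct, smul_dotProduct, smul_eq_mul]
  linear_combination -(L₁ ⬝ᵥ x) ^ 2 * (L₂ ⬝ᵥ x) ^ 2 * hsB

theorem exists_three_terms {p : MvPolynomial (Fin 2) ℝ} {L₁ L₂ : Fin 2 → ℝ}
    (hL : LinearIndependent ℝ ![L₁, L₂]) {A B : ℝ}
    (hp : ∀ x, MvPolynomial.eval x p =
      ((L₁ ⬝ᵥ x) ^ 2 + (L₂ ⬝ᵥ x) ^ 2) * (A * (L₁ ⬝ᵥ x) ^ 2 + B * (L₂ ⬝ᵥ x) ^ 2)) :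
    ∃ (lam : Fin 3 → ℝ) (α : Fin 3 → Fin 2 → ℝ),
      (∀ x, MvPolynomial.eval x p = ∑ j, lam j * (α j ⬝ᵥ x) ^ 4) ∧
      ∀ i j, i ≠ j → LinearIndependent ℝ ![α i, α j] := by
  by_cases hAB : A + B = 0
  · refine ⟨![A, B, 0], ![L₁, L₂, L₁ + L₂], fun x => ?_, ?_⟩
    · rw [hp, Fin.sum_univ_three]
      simp only [Matrix.cons_val_zero, Matrix.cons_val_one, Matrix.cons_val]
      linear_combination (L₁ ⬝ᵥ x) ^ 2 * (L₂ ⬝ᵥ x) ^ 2 * hAB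
    · intro i j hij
      rw [linearIndependent_pair_iff] at hL ⊢
      fin_cases i <;> fin_cases j <;> first | exact absurd rfl hij | skip
      all_goals
        simp
        intro h'
        exact hL (by linarith only [h'])
  by_cases hB : 0 < (A + B) * B
  · exact exists_three_terms_of_pos hL hp hB
  -- The products `(A+B)A` and `(A+B)B` add up to `(A+B)² > 0`, so one is positive; the roles of
  -- `L₁` and `L₂` are exchanged.
  · have hA : 0 < (B + A) * A := by
      have : 0 < (A + B) ^ 2 := by positivity
      nlinarith only [this, hB]
    refine exists_three_terms_of_pos (L₁ := L₂) (L₂ := L₁) ?_ (fun x => ?_) hA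
    · rw [linearIndependent_pair_iff] at hL ⊢
      intro h
      exact hL (by linarith only [h])
    · rw [hp]
      ring

/-- Principal axes: a rotation, scaled by `√(1 + κ²)`, preserves `X² + Y²` up to a factor and
removes the cross term exactly when `κ` solves the quadratic below. -/
theorem exists_diagonalization (a b c : ℝ) : ∃ κ A B : ℝ, ∀ X Y : ℝ,
    (X ^ 2 + Y ^ 2) * (a * X ^ 2 + 2 * b * X * Y + c * Y ^ 2) =
      ((X + κ * Y) ^ 2 + (Y - κ * X) ^ 2) * (A * (X + κ * Y) ^ 2 + B * (Y - κ * X) ^ 2) := by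
  obtain ⟨κ, hκ⟩ : ∃ κ : ℝ, b * (κ * κ) + (a - c) * κ + -b = 0 := by
    by_cases hb : b = 0
    · exact ⟨0, by simp [hb]⟩
    · refine exists_quadratic_eq_zero hb ⟨√(discrim b (a - c) (-b)), ?_⟩
      rw [Real.mul_self_sqrt]
      rw [discrim]
      nlinarith only [sq_nonneg (a - c), sq_nonneg b]
  have hN : 1 + κ ^ 2 ≠ 0 := by positivity
  refine ⟨κ, (a + 2 * b * κ + c * κ ^ 2) / (1 + κ ^ 2) ^ 3,
    (a * κ ^ 2 - 2 * b * κ + c) / (1 + κ ^ 2) ^ 3, fun X Y => ?_⟩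
  rw [← mul_left_inj' (pow_ne_zero 3 hN)]
  field_simp
  linear_combination (-2 * (X ^ 2 + Y ^ 2) * (X + κ * Y) * (Y - κ * X) * (1 + κ ^ 2)) * hκ

/-- Completing the square turns the definite factor into `X² + Y²` with `X = t + (β/2)s`, `Y = δs`.
-/
theorem exists_diagonalization_of_discrim_neg {β γ : ℝ} (h : β ^ 2 - 4 * γ < 0) (h₀ h₁ h₂ : ℝ) :
    ∃ a b c d A B : ℝ, a * d - b * c ≠ 0 ∧ ∀ s t : ℝ,
      (t ^ 2 + β * t * s + γ * s ^ 2) * (h₂ * t ^ 2 + h₁ * t * s + h₀ * s ^ 2) =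
      ((a * s + b * t) ^ 2 + (c * s + d * t) ^ 2) *
        (A * (a * s + b * t) ^ 2 + B * (c * s + d * t) ^ 2) := by
  have hpos : 0 < γ - β ^ 2 / 4 := by linarith
  have hδ : √(γ - β ^ 2 / 4) ^ 2 = γ - β ^ 2 / 4 := Real.sq_sqrt hpos.le
  have hδ0 := (Real.sqrt_pos.2 hpos).ne'
  set δ := √(γ - β ^ 2 / 4)
  obtain ⟨κ, A, B, hAB⟩ := exists_diagonalization h₂ ((h₁ - h₂ * β) / (2 * δ))
    ((h₂ * β ^ 2 / 4 - h₁ * β / 2 + h₀) / δ ^ 2)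
  have hN : 1 + κ ^ 2 ≠ 0 := by positivity
  refine ⟨β / 2 + κ * δ, 1, δ - κ * (β / 2), -κ, A, B, fun h' => mul_ne_zero hδ0 hN (by
    linear_combination -h'), fun s t => ?_⟩
  have := hAB (t + β / 2 * s) (δ * s)
  have h2 : h₂ * (t + β / 2 * s) ^ 2 + 2 * ((h₁ - h₂ * β) / (2 * δ)) * (t + β / 2 * s) * (δ * s) +
      (h₂ * β ^ 2 / 4 - h₁ * β / 2 + h₀) / δ ^ 2 * (δ * s) ^ 2 =
      h₂ * t ^ 2 + h₁ * t * s + h₀ * s ^ 2 := by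
    field_simp
    ring
  rw [h2] at this
  have h1 : (t + β / 2 * s) ^ 2 + (δ * s) ^ 2 = t ^ 2 + β * t * s + γ * s ^ 2 := by
    linear_combination s ^ 2 * hδ
  rw [← h1, this]
  ring

/-! ### Factorization of real quartics -/

theorem exists_irreducible_degree_ne_one_of_not_splits {K : Type*} [Field K] {f : Polynomial K}
    (hf : ¬ f.Splits) : ∃ g, Irreducible g ∧ g ∣ f ∧ g.degree ≠ 1 := by
  classical
  by_contra! h
  have hf0 : f ≠ 0 := fun h0 => hf (h0 ▸ Polynomial.Splits.zero)
  obtain ⟨u, hu⟩ := UniqueFactorizationMonoid.factors_prod hf0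
  refine hf (hu ▸ (Polynomial.Splits.multisetProd fun g hg => ?_).mul u.isUnit.splits)
  exact Polynomial.Splits.of_degree_eq_one (h g (UniqueFactorizationMonoid.irreducible_of_factor g hg)
    (UniqueFactorizationMonoid.dvd_of_mem_factors hg))

theorem discrim_neg_of_irreducible {a b c : ℝ} (ha : a ≠ 0)
    (h : Irreducible (Polynomial.C a * Polynomial.X ^ 2 + Polynomial.C b * Polynomial.X +
      Polynomial.C c)) : b ^ 2 - 4 * a * c < 0 := by
  by_contra! hd
  obtain ⟨x, hx⟩ := exists_quadratic_eq_zero (a := a) (b := b) (c := c) ha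
    ⟨√(discrim a b c), (Real.mul_self_sqrt hd).symm⟩
  have hroot : Polynomial.IsRoot (Polynomial.C a * Polynomial.X ^ 2 +
      Polynomial.C b * Polynomial.X + Polynomial.C c) x := by
    simp [Polynomial.IsRoot]
    linear_combination hx
  have := Polynomial.degree_eq_one_of_irreducible_of_root h hroot
  rw [Polynomial.degree_quadratic ha] at this
  exact absurd this (by decide)

/-- A real quartic is a product of linear factors or has a positive definite quadratic factor. -/
theorem quartic_factorization {f₀ f₁ f₂ f₃ f₄ : ℝ} (h4 : f₄ ≠ 0) :
    (∃ r : Fin 4 → ℝ, ∀ s t : ℝ, f₀ * s ^ 4 + f₁ * s ^ 3 * t + f₂ * s ^ 2 * t ^ 2 +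
      f₃ * s * t ^ 3 + f₄ * t ^ 4 = f₄ * ∏ k, (t - r k * s)) ∨
    ∃ β γ h₀ h₁ h₂ : ℝ, β ^ 2 - 4 * γ < 0 ∧ ∀ s t : ℝ,
      f₀ * s ^ 4 + f₁ * s ^ 3 * t + f₂ * s ^ 2 * t ^ 2 + f₃ * s * t ^ 3 + f₄ * t ^ 4 =
        (t ^ 2 + β * t * s + γ * s ^ 2) * (h₂ * t ^ 2 + h₁ * t * s + h₀ * s ^ 2) := by
  let f : Polynomial ℝ := Polynomial.C f₄ * Polynomial.X ^ 4 + Polynomial.C f₃ * Polynomial.X ^ 3 +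
    Polynomial.C f₂ * Polynomial.X ^ 2 + Polynomial.C f₁ * Polynomial.X + Polynomial.C f₀
  have hdeg : f.natDegree = 4 := by simp only [f]; compute_degree!
  have hlead : f.leadingCoeff = f₄ := by
    rw [Polynomial.leadingCoeff, hdeg]
    simp [f]
  have hf0 : f ≠ 0 := fun h => by simp [h] at hdeg
  have hev : ∀ t, f.eval t = f₀ + f₁ * t + f₂ * t ^ 2 + f₃ * t ^ 3 + f₄ * t ^ 4 := fun t => by
    simp [f]
    ring
  by_cases hs : f.Splits
  · left
    have hcard : f.roots.card = 4 := by rw [← hs.natDegree_eq_card_roots, hdeg]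
    obtain ⟨a, b, c, d, hR⟩ := Multiset.card_eq_four.1 hcard
    refine ⟨![a, b, c, d], ?_⟩
    obtain ⟨e0, e1, e2, e3, -⟩ := quartic_coeff_eq (c0 := f₀) (c1 := f₁) (c2 := f₂) (c3 := f₃)
      (c4 := f₄) (d0 := f₄ * (a * b * c * d))
      (d1 := -f₄ * (b * c * d + a * c * d + a * b * d + a * b * c))
      (d2 := f₄ * (a * b + a * c + a * d + b * c + b * d + c * d))
      (d3 := -f₄ * (a + b + c + d)) (d4 := f₄) (fun t => by
        rw [← hev, hs.eval_eq_prod_roots, hlead, hR]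
        simp
        ring)
    intro s t
    rw [e0, e1, e2, e3, Fin.prod_univ_four]
    simp
    ring
  · right
    obtain ⟨g, hg, ⟨h, hgh⟩, hg1⟩ := exists_irreducible_degree_ne_one_of_not_splits hs
    have hg0 : g ≠ 0 := hg.ne_zero
    have hh0 : h ≠ 0 := fun h' => hf0 (by rw [hgh, h', mul_zero])
    have hgd : g.natDegree = 2 := by
      have h2 : g.natDegree ≤ 2 := Polynomial.natDegree_le_of_degree_le hg.degree_le_two
      have hpos := hg.natDegree_pos
      have hne : g.natDegree ≠ 1 := fun h' => hg1 <| by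
        rw [Polynomial.degree_eq_natDegree hg0, h']
        rfl
      omega
    have hhd : h.natDegree = 2 := by
      have := Polynomial.natDegree_mul hg0 hh0
      rw [← hgh, hdeg, hgd] at this
      omega
    have hgq := Polynomial.eq_quadratic_of_degree_le_two (p := g)
      (Polynomial.degree_le_of_natDegree_le hgd.le)
    have hhq := Polynomial.eq_quadratic_of_degree_le_two (p := h)
      (Polynomial.degree_le_of_natDegree_le hhd.le)
    have hg2 : g.coeff 2 ≠ 0 := by
      rw [← hgd]
      exact Polynomial.leadingCoeff_ne_zero.2 hg0
    set g₀ := g.coeff 0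
    set g₁ := g.coeff 1
    set g₂ := g.coeff 2
    set h₀ := h.coeff 0
    set h₁ := h.coeff 1
    set h₂ := h.coeff 2
    have hdisc := discrim_neg_of_irreducible hg2 (hgq ▸ hg)
    -- `g` is made monic and its leading coefficient is moved into the cofactor.
    refine ⟨g₁ / g₂, g₀ / g₂, g₂ * h₀, g₂ * h₁, g₂ * h₂, ?_, fun s t => ?_⟩
    · have : (g₁ / g₂) ^ 2 - 4 * (g₀ / g₂) = (g₁ ^ 2 - 4 * g₂ * g₀) / g₂ ^ 2 := by field_simp
      rw [this]
      exact div_neg_of_neg_of_pos hdisc (by positivity)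
    · obtain ⟨e0, e1, e2, e3, e4⟩ := quartic_coeff_eq (c0 := f₀) (c1 := f₁) (c2 := f₂) (c3 := f₃)
        (c4 := f₄) (d0 := g₀ * h₀) (d1 := g₀ * h₁ + g₁ * h₀)
        (d2 := g₀ * h₂ + g₁ * h₁ + g₂ * h₀) (d3 := g₁ * h₂ + g₂ * h₁) (d4 := g₂ * h₂) (fun t => by
          rw [← hev, hgh, hgq, hhq]
          simp
          ring)
      rw [e0, e1, e2, e3, e4]
      field_simp
      ring

theorem exists_eval_expansion {d : ℕ} {p : MvPolynomial (Fin 2) ℝ} (hp : p.IsHomogeneous d)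
    (u v : Fin 2 → ℝ) : ∃ c : ℕ → ℝ, ∀ s t : ℝ, MvPolynomial.eval (s • u + t • v) p =
      ∑ j ∈ range (d + 1), c j * s ^ (d - j) * t ^ j := by
  let g : Fin 2 → MvPolynomial (Fin 2) ℝ := fun i =>
    MvPolynomial.C (u i) * MvPolynomial.X 0 + MvPolynomial.C (v i) * MvPolynomial.X 1
  have hg : ∀ i, (g i).IsHomogeneous 1 := fun i =>
    (MvPolynomial.isHomogeneous_C_mul_X _ _).add (MvPolynomial.isHomogeneous_C_mul_X _ _)
  obtain ⟨c, hc⟩ := exists_forall_eval_eq_sum (hp.aeval g hg)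
  rw [one_mul] at hc
  refine ⟨c, fun s t => ?_⟩
  have := hc ![s, t]
  simp only [Matrix.cons_val_zero, Matrix.cons_val_one] at this
  rw [← this, MvPolynomial.aeval_def, ← MvPolynomial.coe_eval₂Hom,
    ← RingHom.comp_apply]
  have hhom : (MvPolynomial.eval ![s, t]).comp (MvPolynomial.eval₂Hom
      (algebraMap ℝ (MvPolynomial (Fin 2) ℝ)) g) = MvPolynomial.eval (s • u + t • v) := by
    ext i
    · simp
    · simp [g, mul_comm]
  rw [hhom]

theorem exists_prod_linForm_or_three_terms {p : MvPolynomial (Fin 2) ℝ} (hp : p.IsHomogeneous 4) :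
    (∃ w : Fin 4 → Fin 2 → ℝ, p = ∏ k, linForm (w k)) ∨
    ∃ (lam : Fin 3 → ℝ) (α : Fin 3 → Fin 2 → ℝ),
      (∀ x, MvPolynomial.eval x p = ∑ j, lam j * (α j ⬝ᵥ x) ^ 4) ∧
      ∀ i j, i ≠ j → LinearIndependent ℝ ![α i, α j] := by
  by_cases h0 : p = 0
  · exact Or.inl ⟨0, by simp [h0, linForm]⟩
  obtain ⟨v, hv⟩ : ∃ v, MvPolynomial.eval v p ≠ 0 := by
    by_contra! h
    exact h0 (MvPolynomial.funext fun x => by simp [h])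
  -- In the basis `perp v`, `v` the coefficient of `t^4` is `p(v) ≠ 0`, so the dehomogenized quartic
  -- has degree exactly 4.
  obtain ⟨f, hf⟩ := exists_eval_expansion hp (perp v) v
  simp only [Finset.sum_range_succ, Finset.sum_range_zero, zero_add, Nat.reduceSub] at hf
  have hf4 : f 4 ≠ 0 := by
    have := hf 0 1
    simp at this
    rwa [← this]
  have hv0 : v ≠ 0 := by
    rintro rfl
    have := hf 0 0
    simp at this hv
    exact hv this
  have hN := (dotProduct_self_pos hv0).ne'
  have hx : ∀ x : Fin 2 → ℝ, x = ((perp v ⬝ᵥ x) / (v ⬝ᵥ v)) • perp v +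
      ((v ⬝ᵥ x) / (v ⬝ᵥ v)) • v := fun x => by
    have hN' : v 0 ^ 2 + v 1 ^ 2 ≠ 0 := by
      simpa only [dotProduct, Fin.sum_univ_two, ← sq] using hN
    ext i
    fin_cases i
    · simp [perp, dotProduct, Fin.sum_univ_two]
      field_simp
      ring
    · simp [perp, dotProduct, Fin.sum_univ_two]
      field_simp
      ring
  have hpx := fun x => (congrArg (fun y => MvPolynomial.eval y p) (hx x)).trans (hf _ _)
  rcases quartic_factorization (f₀ := f 0) (f₁ := f 1) (f₂ := f 2) (f₃ := f 3) hf4 with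
    ⟨r, hr⟩ | ⟨β, γ, h₀, h₁, h₂, hdisc, hh⟩
  · left
    let z : Fin 4 → Fin 2 → ℝ := fun k => (v ⬝ᵥ v)⁻¹ • (v - r k • perp v)
    refine ⟨Function.update z 0 (f 4 • z 0), MvPolynomial.funext fun x => ?_⟩
    have e := hr ((perp v ⬝ᵥ x) / (v ⬝ᵥ v)) ((v ⬝ᵥ x) / (v ⬝ᵥ v))
    have hz : ∀ k, z k ⬝ᵥ x = (v ⬝ᵥ x) / (v ⬝ᵥ v) - r k * ((perp v ⬝ᵥ x) / (v ⬝ᵥ v)) := fun k => by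
      simp only [z, smul_dotProduct, sub_dotProduct, smul_eq_mul]
      ring
    have hprod : ∏ k, (Function.update z 0 (f 4 • z 0) k ⬝ᵥ x) = f 4 * ∏ k, (z k ⬝ᵥ x) := by
      simp only [Fin.prod_univ_four, Function.update_self, smul_dotProduct, smul_eq_mul]
      rw [Function.update_of_ne (by decide), Function.update_of_ne (by decide),
        Function.update_of_ne (by decide)]
      ring
    rw [hpx]
    simp only [map_prod, eval_linForm]
    rw [hprod, Finset.prod_congr rfl fun k _ => hz k, ← e]
    ring
  · right
    obtain ⟨a, b, c, d, A, B, hdet, hAB⟩ := exists_diagonalization_of_discrim_neg hdisc h₀ h₁ h₂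
    have hL : LinearIndependent ℝ
        ![(v ⬝ᵥ v)⁻¹ • (a • perp v + b • v), (v ⬝ᵥ v)⁻¹ • (c • perp v + d • v)] := by
      rw [linearIndependent_pair_iff]
      intro h
      refine mul_ne_zero hdet (inv_ne_zero hN) ?_
      have hi : (v ⬝ᵥ v)⁻¹ * (v 0 * v 0 + v 1 * v 1) = 1 := by
        simpa [dotProduct, Fin.sum_univ_two] using inv_mul_cancel₀ hN
      simp only [Pi.smul_apply, Pi.add_apply, perp, Matrix.cons_val_zero, Matrix.cons_val_one,
        smul_eq_mul] at h
      linear_combination -h - (a * d - b * c) * (v ⬝ᵥ v)⁻¹ * hi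
    refine exists_three_terms hL (A := A) (B := B) fun x => ?_
    rw [hpx]
    have e := hh ((perp v ⬝ᵥ x) / (v ⬝ᵥ v)) ((v ⬝ᵥ x) / (v ⬝ᵥ v))
    rw [hAB] at e
    simp only [smul_dotProduct, add_dotProduct, smul_eq_mul]
    rw [show ∀ y z w : ℝ, (v ⬝ᵥ v)⁻¹ * (y * (perp v ⬝ᵥ x) + z * w) =
      y * ((perp v ⬝ᵥ x) / (v ⬝ᵥ v)) + z * (w / (v ⬝ᵥ v)) from fun y z w => by ring,
      show ∀ y z w : ℝ, (v ⬝ᵥ v)⁻¹ * (y * (perp v ⬝ᵥ x) + z * w) =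
      y * ((perp v ⬝ᵥ x) / (v ⬝ᵥ v)) + z * (w / (v ⬝ᵥ v)) from fun y z w => by ring, ← e]
    ring

/-! ### Definite factors exclude products of linear forms -/

theorem IsDefiniteQuadratic.eval_ne_zero {n : ℕ} {q : MvPolynomial (Fin n) ℝ}
    (hq : IsDefiniteQuadratic q) {v : Fin n → ℝ} (hv : v ≠ 0) : MvPolynomial.eval v q ≠ 0 :=
  hq.2.elim (fun h => (h v hv).ne') fun h => (h v hv).ne

theorem eval_add_add_eval_sub {q : MvPolynomial (Fin 2) ℝ} (hq : q.IsHomogeneous 2)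
    (u v : Fin 2 → ℝ) : MvPolynomial.eval (u + v) q + MvPolynomial.eval (u - v) q =
      2 * (MvPolynomial.eval u q + MvPolynomial.eval v q) := by
  obtain ⟨c, hc⟩ := exists_forall_eval_eq_sum hq
  simp only [hc, Finset.sum_range_succ, Finset.sum_range_zero, Pi.add_apply, Pi.sub_apply]
  ring

/-- A nonzero product of four real linear forms has no definite quadratic factor. -/
theorem not_dvd_prod_linForm_of_isDefiniteQuadratic {q p : MvPolynomial (Fin 2) ℝ}
    (hq : IsDefiniteQuadratic q) (hqp : q ∣ p) (hp : p ≠ 0) (w : Fin 4 → Fin 2 → ℝ) :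
    p ≠ ∏ k, linForm (w k) := by
  intro hw
  obtain ⟨u, hu⟩ : ∃ u, MvPolynomial.eval u p ≠ 0 := by
    by_contra! h
    exact hp (MvPolynomial.funext fun x => by simp [h])
  have hu0 : u ≠ 0 := by
    rintro rfl
    simp only [hw, map_prod, eval_linForm, dotProduct_zero] at hu
    simp at hu
  have hpu : perp u ⬝ᵥ u = 0 := by
    simp [perp, dotProduct, Fin.sum_univ_two]
    ring
  have hline : ∀ t : ℝ, u + t • perp u ≠ 0 := fun t h => by
    have h' := congrArg (· ⬝ᵥ u) h
    simp only [add_dotProduct, smul_dotProduct, hpu, smul_zero, add_zero, zero_dotProduct] at h'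
    exact (dotProduct_self_pos hu0).ne' h'
  have hperp : perp u ≠ 0 := fun h => hu0 <| by
    have e0 := congrFun h 0
    have e1 := congrFun h 1
    simp [perp] at e0 e1
    ext i
    fin_cases i
    · exact e1
    · exact e0
  -- Restriction to the line `u + t • perp u`, which misses the origin. The image of `p` splits,
  -- hence so does that of `q`, which then has a root or is constant.
  let φ : MvPolynomial (Fin 2) ℝ →ₐ[ℝ] Polynomial ℝ := MvPolynomial.aeval fun i =>
    Polynomial.C (perp u i) * Polynomial.X + Polynomial.C (u i)
  have hφ : ∀ f t, (φ f).eval t = MvPolynomial.eval (u + t • perp u) f := fun f t => by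
    have : (Polynomial.evalRingHom t).comp (φ : MvPolynomial (Fin 2) ℝ →+* Polynomial ℝ) =
        MvPolynomial.eval (u + t • perp u) := by
      ext i
      · simp
      · simp [φ]
        ring
    exact congrArg (fun g => g f) this
  have hφp : φ p ≠ 0 := fun h => hu <| by
    have := hφ p 0
    rw [h] at this
    simpa using this.symm
  have hsplit : (φ p).Splits := by
    rw [hw, map_prod]
    refine Polynomial.Splits.prod fun k _ => Polynomial.Splits.of_natDegree_le_one ?_
    have : φ (linForm (w k)) = Polynomial.C (w k ⬝ᵥ perp u) * Polynomial.X +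
        Polynomial.C (w k ⬝ᵥ u) := by
      refine Polynomial.funext fun t => ?_
      rw [hφ, eval_linForm]
      simp [dotProduct_add]
      ring
    rw [this]
    exact Polynomial.natDegree_linear_le
  obtain ⟨t, ht⟩ := (hsplit.of_dvd hφp (map_dvd φ hqp)).exists_eval_eq_zero fun hdeg => by
    have hconst : ∀ t, (φ q).eval t = (φ q).coeff 0 := fun t => by
      rw [Polynomial.eq_C_of_degree_le_zero hdeg.le]
      simp
    have h1 := hconst 1
    have h2 := hconst (-1)
    have h0 := hconst 0
    rw [hφ] at h0 h1 h2
    -- If `q` is constant on the line, the parallelogram law gives `q(perp u) = 0`.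
    have hpar := eval_add_add_eval_sub hq.1 u (perp u)
    rw [one_smul] at h1
    rw [neg_one_smul, ← sub_eq_add_neg] at h2
    rw [zero_smul, add_zero] at h0
    exact hq.eval_ne_zero hperp (by linarith)
  exact hq.eval_ne_zero (hline t) (by rw [← hφ, ht])

/-! ### The dichotomy -/

theorem card_pos_add_card_neg_le {ι : Type*} [Fintype ι] (lam : ι → ℝ) :
    Nat.card {j // 0 < lam j} + Nat.card {j // lam j < 0} ≤ Fintype.card ι := by
  classical
  rw [Nat.card_eq_fintype_card, Nat.card_eq_fintype_card, Fintype.card_subtype,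
    Fintype.card_subtype, ← Finset.card_union_of_disjoint]
  · exact Finset.card_le_univ _
  · exact Finset.disjoint_filter.2 fun j _ h => h.not_gt

/-- A four-term badge has at most four entries in total and dominates `(2,2)`, so it equals `(2,2)`.
-/
theorem hasSignature_two_two {p : MvPolynomial (Fin 2) ℝ} (hp : p.IsHomogeneous 4)
    {w : Fin 4 → Fin 2 → ℝ} (hw : p = ∏ k, linForm (w k))
    (hpow : ∀ v, p ≠ linForm v ^ 4 ∧ p ≠ -linForm v ^ 4) : HasSignature 4 p (2, 2) := by
  obtain ⟨lam, α, h, hα⟩ := exists_four_terms hp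
  have hmem := mem_badges_of_eval lam α h hα
  have hle := two_two_le_of_mem_badges hw hpow hmem
  have hcard : _ ≤ 4 := card_pos_add_card_neg_le lam
  obtain ⟨h1, h2⟩ := Prod.mk_le_mk.1 hle
  refine hasSignature_of_isLeast ⟨?_, fun _ hσ => two_two_le_of_mem_badges hw hpow hσ⟩
  convert! hmem using 2 <;> omega

theorem linearIndependent_perp {v : Fin 2 → ℝ} (hv : v ≠ 0) :
    LinearIndependent ℝ ![v, perp v] := by
  rw [linearIndependent_pair_iff]
  simpa [perp, dotProduct, Fin.sum_univ_two] using (dotProduct_self_pos hv).ne'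

theorem exists_hasSignature_of_mul_pow {p : MvPolynomial (Fin 2) ℝ} {c : ℝ} {v : Fin 2 → ℝ}
    (h : ∀ x, MvPolynomial.eval x p = c * (v ⬝ᵥ x) ^ 4) :
    ∃ σ : ℕ × ℕ, HasSignature 4 p σ ∧ HasSignature 2 (catalecticant 2 p) σ := by
  by_cases hv : v = 0
  · have h1 : (![1, 0] : Fin 2 → ℝ) ≠ 0 := fun h => one_ne_zero (congrFun h 0)
    exact exists_hasSignature_of_three_terms 0 _ (fun x => by simp [h, hv])
      (pairwise_linearIndependent_of_ne_zero (linearIndependent_perp h1) one_ne_zero)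
  · exact exists_hasSignature_of_three_terms ![c, 0, 0] _
      (fun x => by simp [h, Fin.sum_univ_three]) 
      (pairwise_linearIndependent_of_ne_zero (linearIndependent_perp hv) one_ne_zero)

theorem hasSignature_dichotomy {p : MvPolynomial (Fin 2) ℝ} (hp : p.IsHomogeneous 4) :
    (∃ σ : ℕ × ℕ, HasSignature 4 p σ ∧ HasSignature 2 (catalecticant 2 p) σ) ∨
      ((∀ v : Fin 2 → ℝ, p ≠ linForm v ^ 4 ∧ p ≠ -(linForm v ^ 4)) ∧
        (∃ w : Fin 4 → Fin 2 → ℝ, p = ∏ k, linForm (w k)) ∧ HasSignature 4 p (2, 2)) := by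
  rcases exists_prod_linForm_or_three_terms hp with ⟨w, hw⟩ | ⟨lam, α, h, hα⟩
  · by_cases hpow : ∀ v : Fin 2 → ℝ, p ≠ linForm v ^ 4 ∧ p ≠ -(linForm v ^ 4)
    · exact Or.inr ⟨hpow, ⟨w, hw⟩, hasSignature_two_two hp hw hpow⟩
    · left
      push Not at hpow
      obtain ⟨v, hv⟩ := hpow
      by_cases h1 : p = linForm v ^ 4
      · exact exists_hasSignature_of_mul_pow (c := 1) (v := v) fun x => by simp [h1, eval_linForm]
      · exact exists_hasSignature_of_mul_pow (c := -1) (v := v) fun x => by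
          simp [hv h1, eval_linForm]
  · exact Or.inl (exists_hasSignature_of_three_terms lam α h hα)

end BinaryForms

theorem theorem4p2 (p : MvPolynomial (Fin 2) ℝ) (hp : p.IsHomogeneous 4) :
    ((∃ σ : ℕ × ℕ, BinaryForms.HasSignature 4 p σ ∧
        BinaryForms.HasSignature 2 (BinaryForms.catalecticant 2 p) σ) ∨
      ((∀ v : Fin 2 → ℝ, p ≠ BinaryForms.linForm v ^ 4 ∧ p ≠ -(BinaryForms.linForm v ^ 4)) ∧
        (∃ w : Fin 4 → Fin 2 → ℝ, p = ∏ k, BinaryForms.linForm (w k)) ∧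
        BinaryForms.HasSignature 4 p (2, 2))) ∧
    ((∃ q : MvPolynomial (Fin 2) ℝ, BinaryForms.IsDefiniteQuadratic q ∧ q ∣ p) →
      ∃ σ : ℕ × ℕ, BinaryForms.HasSignature 4 p σ ∧
        BinaryForms.HasSignature 2 (BinaryForms.catalecticant 2 p) σ) := by
  refine ⟨BinaryForms.hasSignature_dichotomy hp, fun ⟨q, hq, hqp⟩ => ?_⟩
  rcases BinaryForms.hasSignature_dichotomy hp with h | ⟨hpow, ⟨w, hw⟩, -⟩
  · exact h
  · refine absurd hw (BinaryForms.not_dvd_prod_linForm_of_isDefiniteQuadratic hq hqp (fun h0 => ?_) w)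
    -- The zero form is excluded because it is the fourth power of `ℓ = 0`.
    exact (hpow 0).1 (by simp [h0, BinaryForms.linForm])
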